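/- Let $\mathbb{H}$ be the real quaternions and $\mathbb{DH}=\{p+\varepsilon q : p,q\in\mathbb{H}\}$ the dual quaternions, where $\varepsilon$ is central and $\varepsilon^2=0$. The conjugate of $p+\varepsilon q$ is $\overline{p}+\varepsilon\overline{q}$; conjugation acts coefficientwise on $\mathbb{DH}[t]$, where the indeterminate $t$ commutes with all coefficients. A polynomial $C=P+\varepsilon Q\in\mathbb{DH}[t]$ with $P,Q\in\mathbb{H}[t]$ is called a motion polynomial if $\nu(C):=C\overline{C}=\overline{C}C$ is a nonzero polynomial in $\mathbb{R}[t]$. For $0\neq P\in\mathbb{H}[t]$ let $\operatorname{mrpf}(P)\in\mathbb{R}[t]$ be the unique monic real polynomial factor of $P$ of maximal degree. A motion polynomial $C=P+\varepsilon Q$ is called bounded if $\operatorname{mrpf}(P)$ has no real zeros, and unbounded otherwise. Theorem. Let $C=P+\varepsilon Q\in\mathbb{DH}[t]$ be an unbounded motion polynomial whose leading coefficient is invertible in $\mathbb{DH}$ (for instance, a monic one), and suppose that every real zero of $\operatorname{mrpf}(P)$ has multiplicity one. Then there is a nonzero real polynomial $D\in\mathbb{R}[t]$ such that $CD$ admits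 a factorization with linear motion polynomial factors, that is, $CD=c\,(t-h_1)(t-h_2)\cdots(t-h_n)$ with $n=\deg(CD)\ge 1$ and $c,h_1,\dots,h_n\in\mathbb{DH}$, where every $t-h_i$ is a motion polynomial. -/

import Mathlib

open Polynomial Quaternion DualNumber

namespace MotionPoly

/-- The algebra of dual quaternions: elements `p + ε q` with real quaternions `p`, `q`,
where `ε` commutes with everything and `ε * ε = 0`. -/
abbrev DualQuat : Type := DualNumber ℍ[ℝ]

/-- Conjugation of dual quaternions, `p + ε q ↦ p̄ + ε q̄`. -/
noncomputable def dqConj (a : DualQuat) : DualQuat :=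
  TrivSqZeroExt.inl (star a.fst) + TrivSqZeroExt.inr (star a.snd)

/-- Coefficientwise conjugation of polynomials over the dual quaternions. -/
noncomputable def polyConj (F : DualQuat[X]) : DualQuat[X] :=
  F.sum fun i a => monomial i (dqConj a)

theorem coeff_polyConj (F : DualQuat[X]) (n : ℕ) :
    (polyConj F).coeff n = dqConj (F.coeff n) := by
  have h0 : dqConj 0 = 0 := by simp [dqConj]
  simp only [polyConj, Polynomial.sum, finsetSum_coeff, coeff_monomial, Finset.sum_ite_eq']
  split_ifs with h
  · rfl
  · rw [notMem_support_iff.mp h, h0]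

/-- A real polynomial, seen as a polynomial over the dual quaternions. -/
noncomputable def ofReal (D : ℝ[X]) : DualQuat[X] := D.map (algebraMap ℝ DualQuat)

/-- The norm polynomial `ν(F) = F F̄`. -/
noncomputable def normPoly (F : DualQuat[X]) : DualQuat[X] := F * polyConj F

/-- Motion polynomials: the norm polynomial `F F̄ = F̄ F` is real and nonzero. -/
def IsMotionPolynomial (F : DualQuat[X]) : Prop :=
  (∃ N : ℝ[X], normPoly F = ofReal N ∧ polyConj F * F = ofReal N) ∧ normPoly F ≠ 0

/-- The primal part `P` of `F = P + ε Q`. -/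
noncomputable def primalPart (F : DualQuat[X]) : ℍ[ℝ][X] :=
  F.map (TrivSqZeroExt.fstHom ℝ ℍ[ℝ] ℍ[ℝ] : DualQuat →+* ℍ[ℝ])

/-- The real polynomial `p` is a factor of the quaternion polynomial `P`
(real polynomials are central, so left and right factors agree). -/
def IsRealFactor (p : ℝ[X]) (P : ℍ[ℝ][X]) : Prop := p.map (algebraMap ℝ ℍ[ℝ]) ∣ P

/-- `p` is a monic real polynomial factor of `P` of maximal degree. -/
def IsMaxRealFactor (p : ℝ[X]) (P : ℍ[ℝ][X]) : Prop :=
  p.Monic ∧ IsRealFactor p P ∧ ∀ q : ℝ[X], IsRealFactor q P → q.natDegree ≤ p.natDegree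

theorem exists_isMaxRealFactor {P : ℍ[ℝ][X]} (hP : P ≠ 0) : ∃ p, IsMaxRealFactor p P := by
  classical
  have hb : ∀ q : ℝ[X], IsRealFactor q P → q.natDegree ≤ P.natDegree := by
    rintro q ⟨G, hG⟩
    have h1 : G ≠ 0 := by rintro rfl; simp at hG; exact hP hG
    have h2 : q.map (algebraMap ℝ ℍ[ℝ]) ≠ 0 := by
      intro h; rw [h, zero_mul] at hG; exact hP hG
    rw [hG, natDegree_mul h2 h1, natDegree_map]
    omega
  let T : ℕ → Prop := fun n => ∃ q : ℝ[X], q.Monic ∧ IsRealFactor q P ∧ q.natDegree = n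
  have hT0 : T 0 := ⟨1, monic_one, by simp [IsRealFactor], by simp⟩
  obtain ⟨p, hpm, hpf, hpn⟩ : T (Nat.findGreatest T P.natDegree) :=
    Nat.findGreatest_spec (Nat.zero_le _) hT0
  refine ⟨p, hpm, hpf, fun q hq => ?_⟩
  rw [hpn]
  apply Nat.le_findGreatest (hb q hq)
  have hq0 : q ≠ 0 := by
    rintro rfl
    simp [IsRealFactor] at hq
    exact hP hq
  have hu : IsUnit (C (q.leadingCoeff⁻¹ : ℝ)) :=
    isUnit_C.mpr (inv_ne_zero (leadingCoeff_ne_zero.mpr hq0)).isUnit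
  refine ⟨q * C q.leadingCoeff⁻¹, monic_mul_leadingCoeff_inv hq0, ?_, ?_⟩
  · unfold IsRealFactor
    rw [Polynomial.map_mul]
    obtain ⟨G, hG⟩ := hq
    refine ⟨C (algebraMap ℝ ℍ[ℝ] q.leadingCoeff) * G, ?_⟩
    rw [map_C, mul_assoc, ← mul_assoc (C _) (C _) G, ← C_mul, ← map_mul,
      inv_mul_cancel₀ (leadingCoeff_ne_zero.mpr hq0), map_one, C_1, one_mul, hG]
  · exact natDegree_mul_C (inv_ne_zero (leadingCoeff_ne_zero.mpr hq0))

theorem IsMaxRealFactor.unique {P : ℍ[ℝ][X]} {p q : ℝ[X]}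
    (hp : IsMaxRealFactor p P) (hq : IsMaxRealFactor q P) : p = q := by
  classical
  have key : ∀ {p q : ℝ[X]}, IsMaxRealFactor p P → IsMaxRealFactor q P → q ∣ p := by
    intro p q hp hq
    obtain ⟨hpm, ⟨G, hG⟩, hpx⟩ := hp
    obtain ⟨hqm, ⟨H, hH⟩, -⟩ := hq
    have hd0 : EuclideanDomain.gcd p q ≠ 0 := fun h =>
      hpm.ne_zero (EuclideanDomain.gcd_eq_zero_iff.mp h).1
    have hbez := EuclideanDomain.gcd_eq_gcd_ab p q
    obtain ⟨p', hp'⟩ := EuclideanDomain.gcd_dvd_left p q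
    obtain ⟨q', hq'⟩ := EuclideanDomain.gcd_dvd_right p q
    generalize EuclideanDomain.gcdA p q = a at hbez
    generalize EuclideanDomain.gcdB p q = b at hbez
    generalize EuclideanDomain.gcd p q = d at *
    let φ := mapRingHom (algebraMap ℝ ℍ[ℝ])
    have hφ : ∀ r : ℝ[X], r.map (algebraMap ℝ ℍ[ℝ]) = φ r := fun _ => rfl
    have hl : φ d * P = φ d * (φ (d * p' * q') * (φ b * G + φ a * H)) := by
      have e1 : φ (p * a) * P = φ (d * (d * p' * q')) * (φ a * H) := by
        have : p * a * q = d * (d * p' * q') * a := by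
          conv_lhs => rw [hp', hq']
          ring
        rw [hH, hφ, ← mul_assoc, ← map_mul, this, map_mul, mul_assoc]
      have e2 : φ (q * b) * P = φ (d * (d * p' * q')) * (φ b * G) := by
        have : q * b * p = d * (d * p' * q') * b := by
          conv_lhs => rw [hp', hq']
          ring
        rw [hG, hφ, ← mul_assoc, ← map_mul, this, map_mul, mul_assoc]
      rw [← mul_assoc, ← map_mul, mul_add, ← e1, ← e2, ← add_mul, ← map_add, add_comm, ← hbez]
    have hφd : φ d ≠ 0 := by
      rw [← hφ]
      exact (Polynomial.map_ne_zero_iff (algebraMap ℝ ℍ[ℝ]).injective).mpr hd0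
    have hP' := mul_left_cancel₀ hφd hl
    have hdeg := hpx (d * p' * q') ⟨_, hP'⟩
    have hq0 : q' ≠ 0 := by
      rintro rfl
      exact hqm.ne_zero (by rw [hq', mul_zero])
    rw [← hp', natDegree_mul hpm.ne_zero hq0] at hdeg
    have hu : IsUnit q' := by
      rw [isUnit_iff_degree_eq_zero, degree_eq_natDegree hq0]
      have : q'.natDegree = 0 := by omega
      simp [this]
    obtain ⟨u, rfl⟩ := hu
    rw [hq', Units.mul_right_dvd]
    exact ⟨p', hp'⟩
  exact eq_of_monic_of_associated hp.1 hq.1 (associated_of_dvd_dvd (key hq hp) (key hp hq))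

open Classical in
/-- The maximal real polynomial factor of `P`: the unique monic real factor of maximal degree
(for `P = 0` there is none, and the value is `0`). -/
noncomputable def mrpf (P : ℍ[ℝ][X]) : ℝ[X] :=
  if h : ∃ p, IsMaxRealFactor p P then h.choose else 0

theorem mrpf_eq_iff {P : ℍ[ℝ][X]} (hP : P ≠ 0) {p : ℝ[X]} :
    mrpf P = p ↔ IsMaxRealFactor p P := by
  have h := exists_isMaxRealFactor hP
  have hs : IsMaxRealFactor (mrpf P) P := by
    rw [mrpf, dif_pos h]
    exact h.choose_spec
  exact ⟨fun e => e ▸ hs, fun hp => hs.unique hp⟩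

/-- A motion polynomial is bounded if the maximal real polynomial factor of its primal part has
no real zeros. -/
def IsBounded (F : DualQuat[X]) : Prop := ∀ a : ℝ, ¬ (mrpf (primalPart F)).IsRoot a

/-- `F` admits a factorization `F = c (t - h₁) ⋯ (t - hₙ)`, `n = deg F ≥ 1`, in which all the
linear factors `t - hᵢ` are motion polynomials. -/
def AdmitsMotionFactorization (F : DualQuat[X]) : Prop :=
  1 ≤ F.natDegree ∧ ∃ (c : DualQuat) (h : List DualQuat), h.length = F.natDegree ∧
    (∀ x ∈ h, IsMotionPolynomial (X - C x)) ∧ F = C c * (h.map fun x => X - C x).prod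

end MotionPoly

/-! Write `F = P + εQ` and `P = R P'`, where `R` collects the real linear factors of `mrpf P`, so
that `P'` has no real zero. With the real polynomial `N = P' P̄'` one has `F N = (R N + ε V) P'`, `V
= Q P̄'`. The dual part of the norm condition, after cancelling `R`, says `V̄ = -V`; hence `R N + ε
V` is a translation. The factor `P'` splits by the classical argument for quaternion polynomials, so
only the translation remains.

Translations compose additively: `(A + εV)(B + εW) = AB + ε(AW + BV)`, so the fraction `V/A` is what
matters, real factors being absorbed in `D`. Partial fractions (`AllTranslationsFactor.mul`) reduce
the problem to prime power denominators and one coordinate direction. Polynomial parts of degree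
zero and poles `1/(t - a)` come from a constant and from a single linear factor. For `M = (t - a)² +
b²`, conjugating a translation by linear factors `L`, `L̄` with `L L̄ = M` introduces one more power
of `M` in the denominator (`conj_C_eq`), and an induction reaches all powers. Real linear
denominators are available only to the first power; this is where simplicity of the real zeros of
`mrpf P` enters. -/

namespace MotionPoly

/-! ### Coefficientwise maps, conjugation, and primal and dual parts -/

section Coefficientwise

variable {A B : Type*} [Semiring A] [Semiring B]

/-- Apply an additive map to every coefficient. -/
noncomputable def mapCoeff (L : A →+ B) (P : A[X]) : B[X] :=
  ∑ i ∈ Finset.range (P.natDegree + 1), monomial i (L (P.coeff i))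

theorem coeff_mapCoeff (L : A →+ B) (P : A[X]) (n : ℕ) :
    (mapCoeff L P).coeff n = L (P.coeff n) := by
  simp only [mapCoeff, finsetSum_coeff, coeff_monomial, Finset.sum_ite_eq', Finset.mem_range]
  split_ifs with h
  · rfl
  · rw [coeff_eq_zero_of_natDegree_lt (by omega), map_zero]

theorem natDegree_mapCoeff_le (L : A →+ B) (P : A[X]) :
    (mapCoeff L P).natDegree ≤ P.natDegree :=
  natDegree_le_iff_coeff_eq_zero.mpr fun n hn => by
    rw [coeff_mapCoeff, coeff_eq_zero_of_natDegree_lt hn, map_zero]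

theorem commute_map_algebraMap {R S : Type*} [CommSemiring R] [Semiring S] [Algebra R S]
    (D : R[X]) (P : S[X]) : Commute (D.map (algebraMap R S)) P := by
  induction D using Polynomial.induction_on' with
  | add p q hp hq => rw [Polynomial.map_add]; exact hp.add_left hq
  | monomial n a =>
    rw [map_monomial, ← C_mul_X_pow_eq_monomial]
    refine Commute.mul_left ?_ (commute_X_pow P n)
    ext k
    simp [Algebra.commutes]

end Coefficientwise

/-- Real polynomials as quaternion polynomials. -/
noncomputable abbrev realQuat : ℝ[X] →+* ℍ[ℝ][X] := mapRingHom (algebraMap ℝ ℍ[ℝ])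

/-- Quaternion polynomials as dual quaternion polynomials. -/
noncomputable abbrev quatDual : ℍ[ℝ][X] →+* DualQuat[X] :=
  mapRingHom (TrivSqZeroExt.inlHom ℍ[ℝ] ℍ[ℝ])

/-- The dual unit as a constant polynomial. -/
noncomputable def dualUnit : DualQuat[X] := C (DualNumber.eps : DualQuat)

theorem commute_realQuat (D : ℝ[X]) (P : ℍ[ℝ][X]) : realQuat D * P = P * realQuat D :=
  commute_map_algebraMap D P

theorem commute_ofReal (D : ℝ[X]) (F : DualQuat[X]) : ofReal D * F = F * ofReal D :=
  commute_map_algebraMap D F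

theorem quatDual_realQuat (D : ℝ[X]) : quatDual (realQuat D) = ofReal D := by
  simp only [coe_mapRingHom, ofReal, Polynomial.map_map]
  rfl

theorem ofReal_mul (A B : ℝ[X]) : ofReal (A * B) = ofReal A * ofReal B :=
  Polynomial.map_mul _

theorem dualUnit_mul_self : dualUnit * dualUnit = 0 := by
  rw [dualUnit, ← C_mul, DualNumber.eps_mul_eps, C_0]

theorem dualUnit_commute (F : DualQuat[X]) : dualUnit * F = F * dualUnit := by
  ext n <;> simp [dualUnit]

theorem coeff_quatDual_add (P Q : ℍ[ℝ][X]) (n : ℕ) :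
    (quatDual P + dualUnit * quatDual Q).coeff n =
      TrivSqZeroExt.inl (P.coeff n) + TrivSqZeroExt.inr (Q.coeff n) := by
  ext <;> simp [dualUnit]

theorem exists_quatDual_add (F : DualQuat[X]) :
    ∃ Q : ℍ[ℝ][X], Q.natDegree ≤ F.natDegree ∧
      F = quatDual (primalPart F) + dualUnit * quatDual Q := by
  let L : DualQuat →+ ℍ[ℝ] := (TrivSqZeroExt.sndHom ℍ[ℝ] ℍ[ℝ]).toAddMonoidHom
  refine ⟨mapCoeff L F, natDegree_mapCoeff_le _ _, ?_⟩
  ext1 n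
  rw [coeff_quatDual_add, coeff_mapCoeff]
  ext <;> simp [primalPart, L]

theorem quatDual_add_inj {P Q P' Q' : ℍ[ℝ][X]}
    (h : quatDual P + dualUnit * quatDual Q = quatDual P' + dualUnit * quatDual Q') :
    P = P' ∧ Q = Q' := by
  have hc := fun n => congrArg (fun F => F.coeff n) h
  simp only [coeff_quatDual_add] at hc
  constructor
  · ext1 n
    simpa using congrArg TrivSqZeroExt.fst (hc n)
  · ext1 n
    simpa using congrArg TrivSqZeroExt.snd (hc n)

theorem quatDual_add_mul (P Q P' Q' : ℍ[ℝ][X]) :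
    (quatDual P + dualUnit * quatDual Q) * (quatDual P' + dualUnit * quatDual Q') =
      quatDual (P * P') + dualUnit * quatDual (P * Q' + Q * P') := by
  have h1 : quatDual P * (dualUnit * quatDual Q') = dualUnit * (quatDual P * quatDual Q') := by
    rw [← mul_assoc, ← dualUnit_commute, mul_assoc]
  have h2 : dualUnit * quatDual Q * (dualUnit * quatDual Q') = 0 := by
    rw [mul_assoc, ← mul_assoc _ dualUnit, ← dualUnit_commute, mul_assoc, ← mul_assoc,
      dualUnit_mul_self, zero_mul]
  rw [add_mul, mul_add, mul_add, h1, h2, map_mul, map_add, map_mul, map_mul, mul_add,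
    mul_assoc dualUnit]
  abel

/-- Conjugation of quaternion polynomials. -/
noncomputable def quatConj (P : ℍ[ℝ][X]) : ℍ[ℝ][X] :=
  mapCoeff (starAddEquiv : ℍ[ℝ] ≃+ ℍ[ℝ]).toAddMonoidHom P

theorem coeff_quatConj (P : ℍ[ℝ][X]) (n : ℕ) : (quatConj P).coeff n = star (P.coeff n) :=
  coeff_mapCoeff _ _ _

theorem quatConj_quatConj (P : ℍ[ℝ][X]) : quatConj (quatConj P) = P := by
  ext1 n; simp [coeff_quatConj]

theorem quatConj_add (P Q : ℍ[ℝ][X]) : quatConj (P + Q) = quatConj P + quatConj Q := by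
  ext1 n; simp [coeff_quatConj]

theorem quatConj_mul (P Q : ℍ[ℝ][X]) : quatConj (P * Q) = quatConj Q * quatConj P := by
  ext1 n
  simp only [coeff_quatConj, coeff_mul, star_sum, star_mul]
  rw [← Finset.Nat.sum_antidiagonal_swap]
  simp

theorem quatConj_C (a : ℍ[ℝ]) : quatConj (C a) = C (star a) := by
  ext1 n
  rw [coeff_quatConj, coeff_C, coeff_C]
  split_ifs <;> simp

theorem quatConj_realQuat (D : ℝ[X]) : quatConj (realQuat D) = realQuat D := by
  ext1 n
  simp [coeff_quatConj]

theorem natDegree_quatConj (P : ℍ[ℝ][X]) : (quatConj P).natDegree = P.natDegree :=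
  le_antisymm (natDegree_mapCoeff_le _ _)
    (by conv_lhs => rw [← quatConj_quatConj P]
        exact natDegree_mapCoeff_le _ _)

theorem polyConj_quatDual_add (P Q : ℍ[ℝ][X]) :
    polyConj (quatDual P + dualUnit * quatDual Q) =
      quatDual (quatConj P) + dualUnit * quatDual (quatConj Q) := by
  ext1 n
  rw [coeff_polyConj, coeff_quatDual_add, coeff_quatDual_add, coeff_quatConj, coeff_quatConj]
  simp [dqConj]

theorem exists_realQuat_of_quatConj_eq {P : ℍ[ℝ][X]} (h : quatConj P = P) :
    ∃ N : ℝ[X], realQuat N = P := by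
  let L : ℍ[ℝ] →+ ℝ := ⟨⟨fun q => q.re, by simp⟩, by simp⟩
  refine ⟨mapCoeff L P, ?_⟩
  ext1 n
  have h1 : star (P.coeff n) = P.coeff n := by rw [← coeff_quatConj, h]
  rw [coe_mapRingHom, coeff_map, coeff_mapCoeff]
  exact (Quaternion.star_eq_self.mp h1).symm

theorem exists_realQuat_eq_mul_quatConj (P : ℍ[ℝ][X]) :
    ∃ N : ℝ[X], realQuat N = P * quatConj P :=
  exists_realQuat_of_quatConj_eq (by rw [quatConj_mul, quatConj_quatConj])

/-- `P P̄` is real, hence central, so `P (P̄ P) = (P P̄) P = P (P P̄)`, and `P` cancels. -/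
theorem quatConj_mul_self (P : ℍ[ℝ][X]) : quatConj P * P = P * quatConj P := by
  by_cases hP : P = 0
  · simp [hP, quatConj, mapCoeff]
  obtain ⟨N, hN⟩ := exists_realQuat_eq_mul_quatConj P
  refine mul_left_cancel₀ hP ?_
  rw [← mul_assoc, ← hN, commute_realQuat]

/-! ### The monoid of products of linear motion polynomials -/

/-- A dual quaternion whose norm is a nonzero real number. -/
def IsMotion (c : DualQuat) : Prop :=
  ∃ r : ℝ, r ≠ 0 ∧ c * dqConj c = algebraMap ℝ DualQuat r ∧
    dqConj c * c = algebraMap ℝ DualQuat r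

theorem dqConj_mul (a b : DualQuat) : dqConj (a * b) = dqConj b * dqConj a := by
  ext <;> simp [dqConj] <;> ring

theorem dqConj_dqConj (a : DualQuat) : dqConj (dqConj a) = a := by
  ext <;> simp [dqConj]

theorem algebraMap_dualQuat (r : ℝ) :
    algebraMap ℝ DualQuat r = TrivSqZeroExt.inl (r : ℍ[ℝ]) := rfl

theorem dqConj_algebraMap (r : ℝ) :
    dqConj (algebraMap ℝ DualQuat r) = algebraMap ℝ DualQuat r := by
  simp [dqConj, algebraMap_dualQuat]

theorem isMotion_one : IsMotion 1 :=
  ⟨1, one_ne_zero, by simp [dqConj], by simp [dqConj]⟩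

theorem IsMotion.mul {a b : DualQuat} (ha : IsMotion a) (hb : IsMotion b) : IsMotion (a * b) := by
  obtain ⟨r, hr, h1, h2⟩ := ha
  obtain ⟨s, hs, h3, h4⟩ := hb
  refine ⟨r * s, mul_ne_zero hr hs, ?_, ?_⟩
  · rw [dqConj_mul, mul_assoc, ← mul_assoc b, h3, Algebra.commutes, ← mul_assoc, h1, map_mul]
  · rw [dqConj_mul, mul_assoc, ← mul_assoc _ a, h2, Algebra.commutes, ← mul_assoc, h4, map_mul,
      Algebra.commutes]

theorem isMotion_inl {q : ℍ[ℝ]} (hq : q ≠ 0) : IsMotion (TrivSqZeroExt.inl q) := by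
  refine ⟨Quaternion.normSq q, by simpa using hq, ?_, ?_⟩ <;>
  ext1 <;> simp [dqConj, algebraMap_dualQuat, Quaternion.self_mul_star,
    Quaternion.star_mul_self]

theorem isMotion_one_add_inr {u : ℍ[ℝ]} (hu : star u = -u) :
    IsMotion (1 + TrivSqZeroExt.inr u) := by
  refine ⟨1, one_ne_zero, ?_, ?_⟩ <;> ext1 <;> simp [dqConj, hu]

/-- The linear polynomial `X - C h` has real norm polynomial. -/
def IsMotionRoot (h : DualQuat) : Prop :=
  ∃ s m : ℝ, h + dqConj h = algebraMap ℝ DualQuat s ∧ h * dqConj h = algebraMap ℝ DualQuat m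

theorem IsMotionRoot.isMotionPolynomial {h : DualQuat} (hh : IsMotionRoot h) :
    IsMotionPolynomial (X - C h) := by
  obtain ⟨s, m, h1, h2⟩ := hh
  have hc : dqConj h = algebraMap ℝ DualQuat s - h := by rw [← h1]; abel
  have h3 : dqConj h * h = algebraMap ℝ DualQuat m := by
    rw [← h2, hc, sub_mul, mul_sub, Algebra.commutes]
  have hp : polyConj (X - C h) = X - C (dqConj h) := by
    ext1 n
    rw [coeff_polyConj, coeff_sub, coeff_sub, coeff_X, coeff_C, coeff_C]
    split_ifs <;> ext <;> simp [dqConj]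
  have hN : ofReal (X ^ 2 - C s * X + C m) =
      X ^ 2 - C (algebraMap ℝ DualQuat s) * X + C (algebraMap ℝ DualQuat m) := by
    simp [ofReal]
  have e1 : (X - C h) * (X - C (dqConj h)) = ofReal (X ^ 2 - C s * X + C m) := by
    rw [hN, ← h1, ← h2, C_add, C_mul, sub_mul, mul_sub, mul_sub, X_mul_C, add_mul, sq]
    abel
  have e2 : (X - C (dqConj h)) * (X - C h) = ofReal (X ^ 2 - C s * X + C m) := by
    rw [hN, ← h1, ← h3, C_add, C_mul, sub_mul, mul_sub, mul_sub, X_mul_C, add_mul, sq]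
    abel
  refine ⟨⟨X ^ 2 - C s * X + C m, ?_, ?_⟩, ?_⟩
  · rw [normPoly, hp, e1]
  · rw [hp, e2]
  · rw [normPoly, hp, e1, hN]
    intro h0
    have := congrArg (fun F => F.coeff 2) h0
    simp at this

/-- The witness is `c⁻¹ h c`, with `c⁻¹ = r⁻¹ c̄`; trace and norm are real, hence central, and
survive conjugation. This lets constants move to the left of a product. -/
theorem IsMotionRoot.conj {h c : DualQuat} (hh : IsMotionRoot h) (hc : IsMotion c) :
    ∃ h', IsMotionRoot h' ∧ (X - C h) * C c = C c * (X - C h') := by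
  obtain ⟨s, m, h1, h2⟩ := hh
  obtain ⟨r, hr, h3, h4⟩ := hc
  have hri : algebraMap ℝ DualQuat r⁻¹ * algebraMap ℝ DualQuat r = 1 := by
    rw [← map_mul, inv_mul_cancel₀ hr, map_one]
  have hcj : dqConj (algebraMap ℝ DualQuat r⁻¹ * (dqConj c * h * c)) =
      algebraMap ℝ DualQuat r⁻¹ * (dqConj c * dqConj h * c) := by
    rw [dqConj_mul, dqConj_mul, dqConj_mul, dqConj_dqConj, dqConj_algebraMap, ← Algebra.commutes,
      mul_assoc (dqConj c)]
  refine ⟨algebraMap ℝ DualQuat r⁻¹ * (dqConj c * h * c), ⟨s, m, ?_, ?_⟩, ?_⟩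
  · rw [hcj, ← mul_add, ← add_mul, ← mul_add, h1, ← Algebra.commutes, mul_assoc, h4,
      Algebra.commutes s, ← mul_assoc, hri, one_mul]
  · rw [hcj]
    calc _ = algebraMap ℝ DualQuat r⁻¹ * (dqConj c * h * (c * (algebraMap ℝ DualQuat r⁻¹ *
              dqConj c)) * dqConj h * c) := by simp only [mul_assoc]
      _ = algebraMap ℝ DualQuat r⁻¹ * (dqConj c * (h * dqConj h) * c) := by
        rw [← mul_assoc c, ← Algebra.commutes _ c, mul_assoc _ c, h3, hri, mul_one, mul_assoc _ h]
      _ = _ := by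
        rw [h2, ← Algebra.commutes, mul_assoc _ _ c, h4, Algebra.commutes m, ← mul_assoc, hri,
          one_mul]
  · rw [mul_sub, ← C_mul, ← mul_assoc c, ← Algebra.commutes, mul_assoc _ c, mul_assoc _ h,
      ← mul_assoc c, h3, ← mul_assoc _ (algebraMap ℝ DualQuat r), hri, one_mul, sub_mul, X_mul_C,
      C_mul]

/-- Products of a constant of nonzero real norm with linear motion polynomials. -/
def factorizable : Submonoid DualQuat[X] where
  carrier := {F | ∃ (c : DualQuat) (h : List DualQuat), IsMotion c ∧ (∀ x ∈ h, IsMotionRoot x) ∧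
    F = C c * (h.map fun x => X - C x).prod}
  one_mem' := ⟨1, [], isMotion_one, by simp, by simp⟩
  mul_mem' := by
    rintro _ _ ⟨c, h, hc, hh, rfl⟩ ⟨c', h', hc', hh', rfl⟩
    have key : ∀ l : List DualQuat, (∀ x ∈ l, IsMotionRoot x) → ∃ l' : List DualQuat,
        (∀ x ∈ l', IsMotionRoot x) ∧
        (l.map fun x => X - C x).prod * C c' = C c' * (l'.map fun x => X - C x).prod := by
      intro l hl
      induction l with
      | nil => exact ⟨[], by simp, by simp⟩
      | cons a l ih =>
        obtain ⟨l', h1, h2⟩ := ih fun x hx => hl x (List.mem_cons_of_mem _ hx)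
        obtain ⟨a', h3, h4⟩ := (hl a List.mem_cons_self).conj hc'
        refine ⟨a' :: l', by simpa using ⟨h3, h1⟩, ?_⟩
        rw [List.map_cons, List.prod_cons, mul_assoc, h2, ← mul_assoc, h4, mul_assoc]
        simp
    obtain ⟨l', h1, h2⟩ := key h hh
    refine ⟨c * c', l' ++ h', hc.mul hc', ?_, ?_⟩
    · intro x hx
      rcases List.mem_append.mp hx with hx | hx
      exacts [h1 x hx, hh' x hx]
    · rw [mul_assoc, ← mul_assoc _ (C c'), h2, List.map_append, List.prod_append, C_mul]
      simp only [mul_assoc]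

theorem C_mem_factorizable {c : DualQuat} (hc : IsMotion c) : C c ∈ factorizable :=
  ⟨c, [], hc, by simp, by simp⟩

theorem X_sub_C_mem_factorizable {h : DualQuat} (hh : IsMotionRoot h) :
    X - C h ∈ factorizable :=
  ⟨1, [h], isMotion_one, by simpa using hh, by simp⟩

theorem isMotionRoot_inl (q : ℍ[ℝ]) : IsMotionRoot (TrivSqZeroExt.inl q) := by
  refine ⟨q.re + q.re, Quaternion.normSq q, ?_, ?_⟩ <;>
  ext1 <;> simp [dqConj, algebraMap_dualQuat, Quaternion.self_mul_star,
    Quaternion.self_add_star, two_mul]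

theorem isMotionRoot_translation (a : ℝ) {u : ℍ[ℝ]} (hu : star u = -u) :
    IsMotionRoot (TrivSqZeroExt.inl (a : ℍ[ℝ]) + TrivSqZeroExt.inr u) := by
  refine ⟨2 * a, a ^ 2, ?_, ?_⟩ <;> ext1 <;>
    simp [dqConj, algebraMap_dualQuat, hu, sq, two_mul, Quaternion.coe_commutes]

theorem quatDual_C_mem {q : ℍ[ℝ]} (hq : q ≠ 0) : quatDual (C q) ∈ factorizable := by
  simpa using C_mem_factorizable (isMotion_inl hq)

theorem quatDual_X_sub_C_mem (q : ℍ[ℝ]) : quatDual (X - C q) ∈ factorizable := by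
  simpa using X_sub_C_mem_factorizable (isMotionRoot_inl q)

/-! ### Quaternion polynomials without real zeros -/

theorem exists_eq_of_irreducible_of_eval_ne_zero {p : ℝ[X]} (hp : Irreducible p)
    (h0 : ∀ a : ℝ, p.eval a ≠ 0) :
    ∃ c a b : ℝ, c ≠ 0 ∧ b ≠ 0 ∧ p = C c * ((X - C a) ^ 2 + C (b ^ 2)) := by
  have hform : p = C (p.coeff 2) * X ^ 2 + C (p.coeff 1) * X + C (p.coeff 0) :=
    eq_quadratic_of_degree_le_two hp.degree_le_two
  generalize p.coeff 2 = c at hform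
  generalize p.coeff 1 = d at hform
  generalize p.coeff 0 = e at hform
  have hev : ∀ x : ℝ, p.eval x = c * x ^ 2 + d * x + e := by intro x; rw [hform]; simp
  have hc : c ≠ 0 := by
    rintro rfl
    have hd0 : d = 0 := by
      by_contra hd0
      refine h0 (-e / d) ?_
      rw [hev]; field_simp; ring
    subst hd0
    refine hp.not_isUnit ?_
    rw [hform]
    simp only [map_zero, zero_mul, zero_add, isUnit_C]
    refine IsUnit.mk0 _ fun he => h0 0 ?_
    rw [hev, he]; ring
  have hpos : 0 < e / c - (d / (2 * c)) ^ 2 := by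
    by_contra hn
    push Not at hn
    refine h0 (-(d / (2 * c)) + √((d / (2 * c)) ^ 2 - e / c)) ?_
    have hs := Real.sq_sqrt (show 0 ≤ (d / (2 * c)) ^ 2 - e / c by linarith)
    rw [hev]
    generalize √((d / (2 * c)) ^ 2 - e / c) = s at hs
    have : c * (-(d / (2 * c)) + s) ^ 2 + d * (-(d / (2 * c)) + s) + e =
        c * s ^ 2 - c * ((d / (2 * c)) ^ 2 - e / c) := by field_simp; ring
    rw [this, hs]; ring
  refine ⟨c, -(d / (2 * c)), √(e / c - (d / (2 * c)) ^ 2), hc, (Real.sqrt_pos.mpr hpos).ne', ?_⟩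
  rw [Real.sq_sqrt hpos.le, hform]
  have h1 : C d = C c * (2 * C (d / (2 * c))) := by
    rw [show (2 : ℝ[X]) = C 2 from rfl, ← C_mul, ← C_mul]
    congr 1; field_simp
  have h2 : C e = C c * C (e / c) := by
    rw [← C_mul]; congr 1; field_simp
  rw [h1, h2, C_neg, C_sub, C_pow]
  ring

theorem eval_coe_mul (P Q : ℍ[ℝ][X]) (a : ℝ) :
    (P * Q).eval (a : ℍ[ℝ]) = P.eval (a : ℍ[ℝ]) * Q.eval (a : ℍ[ℝ]) :=
  eval₂_mul_noncomm _ _ fun _ => (Quaternion.coe_commute a _).symm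

theorem eval_realQuat (D : ℝ[X]) (a : ℝ) :
    (realQuat D).eval (a : ℍ[ℝ]) = ((D.eval a : ℝ) : ℍ[ℝ]) := by
  rw [coe_mapRingHom, eval_map]; exact eval₂_at_apply (algebraMap ℝ ℍ[ℝ]) a

theorem eval_quatConj (P : ℍ[ℝ][X]) (a : ℝ) :
    (quatConj P).eval (a : ℍ[ℝ]) = star (P.eval (a : ℍ[ℝ])) := by
  rw [eval_eq_sum_range, eval_eq_sum_range, natDegree_quatConj, star_sum]
  refine Finset.sum_congr rfl fun i _ => ?_
  rw [coeff_quatConj, star_mul, star_pow, Quaternion.star_coe, ← Quaternion.coe_pow,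
    Quaternion.coe_commutes]

theorem exists_realQuat_X_sub_C_mul {P : ℍ[ℝ][X]} {a : ℝ} (h : P.eval (a : ℍ[ℝ]) = 0) :
    ∃ G, P = realQuat (X - C a) * G := by
  have hm : (X - C (a : ℍ[ℝ])).Monic := monic_X_sub_C _
  have e := modByMonic_add_div P (X - C (a : ℍ[ℝ]))
  have hr : P %ₘ (X - C (a : ℍ[ℝ])) = C ((P %ₘ (X - C (a : ℍ[ℝ]))).coeff 0) := by
    refine eq_C_of_degree_le_zero ?_
    have := degree_modByMonic_lt P hm
    rw [degree_X_sub_C] at this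
    exact Order.le_of_lt_succ this
  have h0 : (P %ₘ (X - C (a : ℍ[ℝ]))).coeff 0 = 0 := by
    have h1 := congrArg (eval (a : ℍ[ℝ])) e
    rw [eval_add, eval_coe_mul, h, hr] at h1
    simpa using h1
  refine ⟨P /ₘ (X - C (a : ℍ[ℝ])), ?_⟩
  conv_lhs => rw [← e, hr, h0]
  simp

theorem realQuat_quadratic (a b : ℝ) {n : ℍ[ℝ]} (hn : n * n = -((b ^ 2 : ℝ) : ℍ[ℝ])) :
    realQuat ((X - C a) ^ 2 + C (b ^ 2)) =
      (X - C ((a : ℍ[ℝ]) + n)) * (X - C ((a : ℍ[ℝ]) - n)) := by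
  have h1 : realQuat ((X - C a) ^ 2 + C (b ^ 2)) =
      (X - C (a : ℍ[ℝ])) * (X - C (a : ℍ[ℝ])) - C (n * n) := by
    rw [hn, C_neg, sub_neg_eq_add, map_add, map_pow, sq]
    simp
  have hc : C n * (X - C (a : ℍ[ℝ])) = (X - C (a : ℍ[ℝ])) * C n := by
    rw [mul_sub, sub_mul, X_mul_C, ← C_mul, ← C_mul, Quaternion.coe_commutes]
  rw [h1, C_add, C_sub, ← sub_sub, ← sub_add, C_mul]
  exact Commute.mul_self_sub_mul_self_eq' hc.symm

/-- Imaginary quaternions anticommute when they are orthogonal, so `n` is a vector of length `|b|`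
orthogonal to `v`. It is sought in the `i`,`j`-plane, by a quarter turn of the projection of `v`.
With `v = 0` this just supplies a square root of `-b²`. -/
theorem exists_anticommuting (b : ℝ) {v : ℍ[ℝ]} (hv : star v = -v) :
    ∃ n : ℍ[ℝ], star n = -n ∧ n * n = -((b ^ 2 : ℝ) : ℍ[ℝ]) ∧ n * v = -(v * n) := by
  have hv0 : v.re = 0 := by
    have := congrArg (fun q : ℍ[ℝ] => q.re) hv
    simp only [Quaternion.re_star, Quaternion.re_neg] at this
    linarith
  obtain ⟨x, y, hxy, ho⟩ : ∃ x y : ℝ, x * x + y * y = b ^ 2 ∧ x * v.imI + y * v.imJ = 0 := by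
    by_cases h : v.imI ^ 2 + v.imJ ^ 2 = 0
    · have h1 : v.imI = 0 := by nlinarith [sq_nonneg v.imI, sq_nonneg v.imJ]
      have h2 : v.imJ = 0 := by nlinarith [sq_nonneg v.imI, sq_nonneg v.imJ]
      exact ⟨b, 0, by ring, by rw [h1, h2]; ring⟩
    · have hp : 0 < v.imI ^ 2 + v.imJ ^ 2 := lt_of_le_of_ne (by positivity) (Ne.symm h)
      have hs := Real.sq_sqrt hp.le
      have hs0 := (Real.sqrt_pos.mpr hp).ne'
      generalize √(v.imI ^ 2 + v.imJ ^ 2) = s at hs hs0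
      refine ⟨-(b * v.imJ / s), b * v.imI / s, ?_, by ring⟩
      field_simp
      linear_combination -b ^ 2 * hs
  obtain ⟨n, h1, h2, h3, h4⟩ : ∃ n : ℍ[ℝ], n.re = 0 ∧ n.imI = x ∧ n.imJ = y ∧ n.imK = 0 :=
    ⟨⟨0, x, y, 0⟩, rfl, rfl, rfl, rfl⟩
  refine ⟨n, ?_, ?_, ?_⟩
  · ext <;> simp [*]
  · rw [← hxy]
    ext <;> simp [h1, h2, h3, h4, -Quaternion.coe_add, -Quaternion.coe_mul] <;> ring
  · ext <;> simp [h1, h2, h3, h4, hv0] <;> linarith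

theorem quadratic_monic_and_natDegree (a b : ℝ) :
    ((X - C a) ^ 2 + C (b ^ 2) : ℝ[X]).Monic ∧
      ((X - C a) ^ 2 + C (b ^ 2) : ℝ[X]).natDegree = 2 := by
  have h2 : ((X - C a) ^ 2 : ℝ[X]).natDegree = 2 := by
    rw [natDegree_pow, natDegree_X_sub_C]
  have hm : ((X - C a) ^ 2 : ℝ[X]).Monic := (monic_X_sub_C a).pow 2
  refine ⟨hm.add_of_left ?_, by rw [natDegree_add_C, h2]⟩
  rw [degree_eq_natDegree hm.ne_zero, h2]
  exact degree_C_le.trans_lt (by norm_num)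

theorem quatConj_X_sub_C (h : ℍ[ℝ]) : quatConj (X - C h) = X - C (star h) := by
  ext1 n
  rw [coeff_quatConj, coeff_sub, coeff_sub, coeff_X, coeff_C, coeff_C]
  split_ifs <;> simp

theorem X_sub_C_mul_star (h : ℍ[ℝ]) :
    (X - C (star h)) * (X - C h) = (X - C h) * (X - C (star h)) := by
  have := quatConj_mul_self (X - C h)
  rwa [quatConj_X_sub_C] at this

/-- Comparing leading coefficients gives `k = q q'`; since `m` is central, both constants then
cancel. -/
theorem eq_of_C_mul_mul_C {R : Type*} [Ring R] [IsDomain R] {q q' k : R} {S m : R[X]}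
    (hq : q ≠ 0) (hq' : q' ≠ 0) (hS : S.Monic) (hm : m.Monic) (hmc : ∀ Q, m * Q = Q * m)
    (h : C q * S * C q' = m * C k) : S = m := by
  have hlead := congrArg leadingCoeff h
  rw [leadingCoeff_mul, leadingCoeff_mul, leadingCoeff_mul (p := m), hS.leadingCoeff,
    hm.leadingCoeff, leadingCoeff_C, leadingCoeff_C, leadingCoeff_C, mul_one, one_mul] at hlead
  rw [← hlead, C_mul, ← mul_assoc] at h
  have h2 := mul_right_cancel₀ (C_ne_zero.mpr hq') h
  rw [hmc] at h2
  exact mul_left_cancel₀ (C_ne_zero.mpr hq) h2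

/-- A quaternion polynomial without real zeros is a product of linear factors. -/
theorem quatDual_mem_factorizable {P : ℍ[ℝ][X]} (hP : ∀ a : ℝ, P.eval (a : ℍ[ℝ]) ≠ 0) :
    quatDual P ∈ factorizable := by
  induction hd : P.natDegree using Nat.strong_induction_on generalizing P with
  | _ d ih =>
  have hP0 : P ≠ 0 := by rintro rfl; exact hP 0 (by simp)
  rcases Nat.eq_zero_or_pos d with rfl | hpos
  · rw [eq_C_of_natDegree_eq_zero hd] at hP0 ⊢
    exact quatDual_C_mem (by simpa using hP0)
  obtain ⟨N, hN⟩ := exists_realQuat_eq_mul_quatConj P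
  have hcP : quatConj P ≠ 0 := by
    intro h
    have := natDegree_quatConj P
    rw [h, natDegree_zero] at this
    omega
  have hNd : 0 < N.natDegree := by
    have h1 : (realQuat N).natDegree = N.natDegree := natDegree_map _
    rw [← h1, hN, natDegree_mul hP0 hcP]
    omega
  -- A real zero of the norm would be a real zero of `P`, so each irreducible factor of the norm is
  -- a quadratic without real zeros.
  obtain ⟨p, hpi, hpN⟩ := exists_irreducible_of_natDegree_pos hNd
  have hp0 : ∀ a : ℝ, p.eval a ≠ 0 := by
    intro a ha
    have h1 : N.eval a = 0 := eval_eq_zero_of_dvd_of_eval_eq_zero hpN ha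
    have h2 := eval_realQuat N a
    rw [hN, eval_coe_mul, eval_quatConj, h1, Quaternion.coe_zero] at h2
    rcases mul_eq_zero.mp h2 with h | h
    · exact hP a h
    · exact hP a (star_eq_zero.mp h)
  obtain ⟨c, a, b, hc, hb, rfl⟩ := exists_eq_of_irreducible_of_eval_ne_zero hpi hp0
  obtain ⟨hMm, hMd⟩ := quadratic_monic_and_natDegree a b
  obtain ⟨n, -, hn, -⟩ := exists_anticommuting b (v := 0) (by simp)
  have hfac := realQuat_quadratic a b hn
  obtain ⟨K0, hK0⟩ := (dvd_mul_left _ _).trans hpN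
  set M : ℝ[X] := (X - C a) ^ 2 + C (b ^ 2) with hMdef
  set m := realQuat M with hm
  have hmm : m.Monic := hMm.map _
  have hmd : m.natDegree = 2 := by rw [hm, ← hMd]; exact natDegree_map _
  have hmc : ∀ Q, m * Q = Q * m := commute_realQuat M
  have hmconj : quatConj m = m := quatConj_realQuat M
  have hPP : P * quatConj P = m * realQuat K0 := by rw [← hN, hK0, map_mul]
  have hdiv : P = P %ₘ m + m * (P /ₘ m) := (modByMonic_add_div P m).symm
  have hrd : (P %ₘ m).degree ≤ 1 := by
    have := degree_modByMonic_lt P hmm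
    rw [degree_eq_natDegree hmm.ne_zero, hmd] at this
    exact Order.le_of_lt_succ this
  have hrform := eq_X_add_C_of_degree_le_one hrd
  generalize (P %ₘ m).coeff 1 = q at hrform
  generalize (P %ₘ m).coeff 0 = s at hrform
  generalize P %ₘ m = r at hdiv hrform
  generalize P /ₘ m = G at hdiv
  -- Modulo the central real polynomial `m`, `P` is congruent to its remainder `r`, so `m` divides
  -- the norm of `r` as well.
  obtain ⟨K, hK⟩ : ∃ K, r * quatConj r = m * K := by
    refine ⟨realQuat K0 - (r * quatConj G + G * quatConj P), ?_⟩
    have h1 : P * quatConj P = r * quatConj r + m * (r * quatConj G + G * quatConj P) := by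
      have h2 : r * quatConj P = r * quatConj r + m * (r * quatConj G) := by
        conv_lhs => rw [hdiv]
        rw [quatConj_add, quatConj_mul, hmconj, mul_add, ← mul_assoc, ← hmc]
      conv_lhs => enter [1]; rw [hdiv]
      rw [add_mul, h2, mul_add m, mul_assoc m]
      abel
    rw [mul_sub, ← hPP, h1]
    abel
  by_cases hr : r = 0
  · rw [hr, zero_add] at hdiv
    have hG : ∀ x : ℝ, G.eval (x : ℍ[ℝ]) ≠ 0 := by
      intro x hx
      refine hP x ?_
      rw [hdiv, eval_coe_mul, hx, mul_zero]
    have hG0 : G ≠ 0 := by rintro rfl; exact hG 0 (by simp)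
    have hdG : G.natDegree < d := by
      rw [← hd, hdiv, natDegree_mul hmm.ne_zero hG0]; omega
    rw [hdiv, hfac, map_mul, map_mul]
    exact mul_mem (mul_mem (quatDual_X_sub_C_mem _) (quatDual_X_sub_C_mem _)) (ih _ hdG hG rfl)
  have hcr : quatConj r ≠ 0 := fun h => hr (by
    rw [← quatConj_quatConj r, h]; simp [quatConj, mapCoeff])
  have hK0' : K ≠ 0 := by
    rintro rfl
    rw [mul_zero] at hK
    exact mul_ne_zero hr hcr hK
  -- As `r` has degree at most one, this forces `r` to be linear and `K` constant; `m` is then the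
  -- norm of the monic linear factor of `r`.
  have hdegr : r.natDegree + r.natDegree = 2 + K.natDegree := by
    have := congrArg natDegree hK
    rwa [natDegree_mul hr hcr, natDegree_quatConj, natDegree_mul hmm.ne_zero hK0', hmd] at this
  have hq : q ≠ 0 := by
    rintro rfl
    have : r.natDegree = 0 := by rw [hrform]; simp
    omega
  have hr1 : r.natDegree = 1 := by
    rw [hrform]; exact natDegree_linear hq
  have hKd : K.natDegree = 0 := by omega
  set h := -(q⁻¹ * s) with hh
  have hrl : r = C q * (X - C h) := by
    rw [hrform, hh, C_neg, sub_neg_eq_add, mul_add, ← C_mul, ← mul_assoc, mul_inv_cancel₀ hq,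
      one_mul]
  have hS : (X - C h) * (X - C (star h)) = m := by
    rw [eq_C_of_natDegree_eq_zero hKd, hrl, quatConj_mul, quatConj_C, quatConj_X_sub_C,
      mul_assoc (C q), ← mul_assoc (X - C h), ← mul_assoc (C q)] at hK
    exact eq_of_C_mul_mul_C hq (star_ne_zero.mpr hq)
      ((monic_X_sub_C _).mul (monic_X_sub_C _)) hmm hmc hK
  -- `X - C h` divides `r` on the right, and also `m`, hence it divides `P`.
  have hfac2 : P = (C q + G * (X - C (star h))) * (X - C h) := by
    rw [add_mul, mul_assoc, X_sub_C_mul_star, hS, ← hrl, ← hmc]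
    exact hdiv
  set A := C q + G * (X - C (star h)) with hA
  have hAz : ∀ x : ℝ, A.eval (x : ℍ[ℝ]) ≠ 0 := by
    intro x hx
    refine hP x ?_
    rw [hfac2, eval_coe_mul, hx, zero_mul]
  have hA0 : A ≠ 0 := fun h => hAz 0 (by simp [h])
  have hdA : A.natDegree < d := by
    rw [← hd, hfac2, natDegree_mul hA0 (X_sub_C_ne_zero h), natDegree_X_sub_C]; omega
  rw [hfac2, map_mul]
  exact mul_mem (ih _ hdA hAz rfl) (quatDual_X_sub_C_mem _)

/-! ### Translations modulo real factors -/

/-- The polynomial `A + ε V` with real primal part. -/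
noncomputable def translation (A : ℝ[X]) (V : ℍ[ℝ][X]) : DualQuat[X] :=
  quatDual (realQuat A) + dualUnit * quatDual V

/-- `A + ε V` has a real multiple that is a product of linear motion polynomials. -/
def TranslationFactors (A : ℝ[X]) (V : ℍ[ℝ][X]) : Prop :=
  ∃ D : ℝ[X], D ≠ 0 ∧ translation A V * ofReal D ∈ factorizable

theorem translation_mul (A B : ℝ[X]) (V W : ℍ[ℝ][X]) :
    translation A V * translation B W =
      translation (A * B) (realQuat A * W + realQuat B * V) := by
  rw [translation, translation, quatDual_add_mul, commute_realQuat B, ← map_mul realQuat]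
  rfl

theorem translation_realQuat_mul (B A : ℝ[X]) (V : ℍ[ℝ][X]) :
    translation (B * A) (realQuat B * V) = translation A V * ofReal B := by
  have : ofReal B = translation B 0 := by simp [translation, ← quatDual_realQuat]
  rw [this, translation_mul, mul_zero, zero_add, mul_comm]

namespace TranslationFactors

theorem mul {A B : ℝ[X]} {V W : ℍ[ℝ][X]} (h1 : TranslationFactors A V)
    (h2 : TranslationFactors B W) :
    TranslationFactors (A * B) (realQuat A * W + realQuat B * V) := by
  obtain ⟨D, hD, h1⟩ := h1
  obtain ⟨D', hD', h2⟩ := h2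
  refine ⟨D * D', mul_ne_zero hD hD', ?_⟩
  have : translation A V * ofReal D * (translation B W * ofReal D') =
      translation A V * translation B W * ofReal (D * D') := by
    rw [ofReal_mul, mul_assoc, ← mul_assoc (ofReal D), commute_ofReal, ← mul_assoc,
      ← mul_assoc, mul_assoc]
  rw [← translation_mul, ← this]
  exact mul_mem h1 h2

theorem cancel {A B : ℝ[X]} {V : ℍ[ℝ][X]} (hB : B ≠ 0)
    (h : TranslationFactors (B * A) (realQuat B * V)) : TranslationFactors A V := by
  obtain ⟨D, hD, h⟩ := h
  refine ⟨B * D, mul_ne_zero hB hD, ?_⟩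
  rwa [ofReal_mul, ← mul_assoc, ← translation_realQuat_mul]

/-- The product of `A + εV` and `A + εW` is `A (A + ε(V + W))`; the extra real factor is harmless.
-/
theorem add {A : ℝ[X]} {V W : ℍ[ℝ][X]} (hA : A ≠ 0) (h1 : TranslationFactors A V)
    (h2 : TranslationFactors A W) : TranslationFactors A (V + W) := by
  refine cancel hA ?_
  have := h1.mul h2
  rwa [← mul_add, add_comm] at this

theorem of_mem {A : ℝ[X]} {V : ℍ[ℝ][X]} (h : translation A V ∈ factorizable) :
    TranslationFactors A V :=
  ⟨1, one_ne_zero, by simpa [ofReal] using h⟩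

theorem const {u : ℍ[ℝ]} (hu : star u = -u) : TranslationFactors 1 (C u) := by
  refine of_mem ?_
  convert C_mem_factorizable (isMotion_one_add_inr hu) using 1
  ext1 n
  rw [translation, coeff_quatDual_add, map_one, coeff_one, coeff_C, coeff_C]
  split_ifs <;> simp

theorem linear (a : ℝ) {u : ℍ[ℝ]} (hu : star u = -u) : TranslationFactors (X - C a) (C u) := by
  refine of_mem ?_
  convert X_sub_C_mem_factorizable (isMotionRoot_translation a (u := -u) (by simp [hu])) using 1
  ext1 n
  rw [translation, coeff_quatDual_add, map_sub, coeff_sub, coeff_sub, coeff_C, coeff_C,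
    coe_mapRingHom, map_X, map_C, coeff_X, coeff_C, coeff_X]
  split_ifs <;> ext1 <;> simp

theorem unit {c : ℝ} (hc : c ≠ 0) : TranslationFactors (C c) 0 := by
  refine of_mem ?_
  have : ((c : ℝ) : ℍ[ℝ]) ≠ 0 := by
    rw [← Quaternion.coe_zero]
    exact fun h => hc (Quaternion.coe_injective h)
  simpa [translation] using quatDual_C_mem this

theorem quadratic (a b : ℝ) : TranslationFactors ((X - C a) ^ 2 + C (b ^ 2)) 0 := by
  refine of_mem ?_
  obtain ⟨n, -, hn, -⟩ := exists_anticommuting b (v := 0) (by simp)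
  rw [translation, realQuat_quadratic a b hn, map_zero, mul_zero, add_zero, map_mul]
  exact mul_mem (quatDual_X_sub_C_mem _) (quatDual_X_sub_C_mem _)

theorem lift {A B : ℝ[X]} {V : ℍ[ℝ][X]} (hB : TranslationFactors B 0)
    (h : TranslationFactors A V) : TranslationFactors (B * A) (realQuat B * V) := by
  simpa using hB.mul h

/-- Multiply `A + εV` by the two conjugate linear factors; their product is the real quadratic,
which is central. -/
theorem conj {A : ℝ[X]} {V : ℍ[ℝ][X]} (h : TranslationFactors A V) (a b : ℝ) {n : ℍ[ℝ]}
    (hn : n * n = -((b ^ 2 : ℝ) : ℍ[ℝ])) :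
    TranslationFactors (((X - C a) ^ 2 + C (b ^ 2)) * A)
      ((X - C ((a : ℍ[ℝ]) + n)) * V * (X - C ((a : ℍ[ℝ]) - n))) := by
  obtain ⟨D, hD, h⟩ := h
  refine ⟨D, hD, ?_⟩
  set L := X - C ((a : ℍ[ℝ]) + n) with hL
  set R := X - C ((a : ℍ[ℝ]) - n) with hR
  have h1 : ∀ P : ℍ[ℝ][X], quatDual P = quatDual P + dualUnit * quatDual 0 := by simp
  have hA : L * (realQuat A * R) = L * R * realQuat A := by rw [commute_realQuat, mul_assoc]
  have e0 : quatDual L * (translation A V * quatDual R) =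
      translation (((X - C a) ^ 2 + C (b ^ 2)) * A) (L * V * R) := by
    rw [translation, translation, h1 L, h1 R, quatDual_add_mul, quatDual_add_mul,
      map_mul realQuat, realQuat_quadratic a b hn, hA, mul_zero, zero_add, zero_mul, add_zero,
      mul_assoc L V]
  have e : quatDual L * (translation A V * ofReal D) * quatDual R =
      translation (((X - C a) ^ 2 + C (b ^ 2)) * A) (L * V * R) * ofReal D := by
    rw [← e0, mul_assoc, mul_assoc, commute_ofReal, ← mul_assoc (translation A V), ← mul_assoc]
  rw [← e]
  exact mul_mem (mul_mem (quatDual_X_sub_C_mem _) h) (quatDual_X_sub_C_mem _)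

end TranslationFactors

/-! ### Raising the power of a quadratic denominator -/

/-- With `L` and `R` the outer factors, anticommutation gives `u R = L u`, so the left side is `L²
u`. Substituting `L = R - 2n` in one factor and using that `L R` is the quadratic yields the
formula. -/
theorem conj_C_eq (a b : ℝ) {n u : ℍ[ℝ]} (hn : n * n = -((b ^ 2 : ℝ) : ℍ[ℝ]))
    (hu : n * u = -(u * n)) :
    (X - C ((a : ℍ[ℝ]) + n)) * C u * (X - C ((a : ℍ[ℝ]) - n)) =
      realQuat ((X - C a) ^ 2 + C (b ^ 2)) * C u - (2 * b ^ 2) • C u -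
        (2 : ℝ) • (realQuat (X - C a) * C (n * u)) := by
  have h1 : C u * (X - C ((a : ℍ[ℝ]) - n)) = (X - C ((a : ℍ[ℝ]) + n)) * C u := by
    rw [mul_sub, sub_mul, X_mul_C, ← C_mul, ← C_mul, mul_sub, add_mul, hu, ← sub_eq_add_neg,
      Quaternion.coe_commutes]
  have h2 : (X - C ((a : ℍ[ℝ]) + n)) = (X - C ((a : ℍ[ℝ]) - n)) - (2 : ℝ) • C n := by
    rw [C_add, C_sub]; module
  have h3 : (X - C ((a : ℍ[ℝ]) - n)) = realQuat (X - C a) + C n := by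
    simp only [C_sub, coe_mapRingHom, Polynomial.map_sub, map_X, map_C]
    rw [← sub_add]
    rfl
  have h4 : C n * realQuat (X - C a) = realQuat (X - C a) * C n := (commute_realQuat _ _).symm
  have h5 : C n * C n * C u = -(b ^ 2 : ℝ) • C u := by
    rw [← C_mul, ← C_mul, hn, smul_C]
    congr 1
    rw [neg_mul, neg_smul, Quaternion.coe_mul_eq_smul]
  rw [mul_assoc, h1, ← mul_assoc, realQuat_quadratic a b hn]
  conv_lhs => enter [1, 2]; rw [h2]
  rw [mul_sub, sub_mul, mul_smul_comm, smul_mul_assoc]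
  have h6 : (X - C ((a : ℍ[ℝ]) + n)) * C n * C u =
      realQuat (X - C a) * C (n * u) + (b ^ 2 : ℝ) • C u := by
    rw [h2, h3, C_mul, sub_mul, add_mul, sub_mul, add_mul, smul_mul_assoc, smul_mul_assoc, h5,
      mul_assoc]
    module
  rw [h6]
  module

namespace TranslationFactors

theorem quadratic_mul_const {A : ℝ[X]} (hA : A ≠ 0) (a : ℝ) {b : ℝ} (hb : b ≠ 0)
    (h : ∀ u : ℍ[ℝ], star u = -u → TranslationFactors A (C u)) {u : ℍ[ℝ]} (hu : star u = -u) :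
    TranslationFactors (((X - C a) ^ 2 + C (b ^ 2)) * A) (C u) := by
  have hM : ((X - C a) ^ 2 + C (b ^ 2) : ℝ[X]) ≠ 0 := (quadratic_monic_and_natDegree a b).1.ne_zero
  obtain ⟨n, -, hn, hnu⟩ := exists_anticommuting b hu
  -- Conjugating with `n` and with `-n` cancels the linear terms and leaves `2Mv - 4b²v`, where `M`
  -- is the quadratic. Adding `-2Mv` leaves `-4b²v`, which is `u` for this scaling.
  set v : ℍ[ℝ] := (-(1 / (4 * b ^ 2)) : ℝ) • u with hvdef
  have hv : star v = -v := by rw [hvdef, Quaternion.star_smul, hu, smul_neg]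
  have hnv : n * v = -(v * n) := by
    rw [hvdef, mul_smul_comm, smul_mul_assoc, hnu, smul_neg]
  have e1 := (h v hv).conj a b hn
  have e2 := (h v hv).conj a b (n := -n) (by rw [neg_mul_neg, hn])
  have e3 := lift (quadratic a b) (h ((-2 : ℝ) • v) (by rw [Quaternion.star_smul, hv, smul_neg]))
  rw [conj_C_eq a b hn hnv] at e1
  rw [conj_C_eq a b (by rw [neg_mul_neg, hn]) (by rw [neg_mul, mul_neg, hnv])] at e2
  convert ((e1.add (mul_ne_zero hM hA) e2).add (mul_ne_zero hM hA) e3) using 1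
  have h1 : (C u : ℍ[ℝ][X]) = (-(4 * b ^ 2) : ℝ) • C v := by
    rw [hvdef, smul_C, smul_smul]
    congr 1
    rw [show -(4 * b ^ 2) * -(1 / (4 * b ^ 2)) = 1 by field_simp, one_smul]
  clear_value v
  rw [h1, neg_mul, C_neg, mul_neg, ← smul_C, mul_smul_comm]
  module

theorem quadratic_mul_linear {A : ℝ[X]} (hA : A ≠ 0) (a : ℝ) {b : ℝ} (hb : b ≠ 0)
    (h : ∀ u : ℍ[ℝ], star u = -u → TranslationFactors A (C u)) {v : ℍ[ℝ]} (hv : star v = -v) :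
    TranslationFactors (((X - C a) ^ 2 + C (b ^ 2)) * A) (realQuat (X - C a) * C v) := by
  have hM : ((X - C a) ^ 2 + C (b ^ 2) : ℝ[X]) ≠ 0 := (quadratic_monic_and_natDegree a b).1.ne_zero
  obtain ⟨n, hn0, hn, hnv⟩ := exists_anticommuting b hv
  -- Chosen so that `n u = -v/2`: the linear term of the conjugate becomes `(t - a) v`. The other
  -- terms, `Mu` and `-2b²u`, are removed by translations already available.
  set u : ℍ[ℝ] := (1 / (2 * b ^ 2) : ℝ) • (n * v) with hudef
  have hu : star u = -u := by
    rw [hudef, Quaternion.star_smul, star_mul, hv, hn0, neg_mul_neg, hnv, smul_neg, neg_neg]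
  have hnu : n * u = -(u * n) := by
    rw [hudef, mul_smul_comm, smul_mul_assoc, mul_assoc, ← smul_neg, ← mul_neg, hnv]
  have hnu2 : n * u = (-(1 / 2) : ℝ) • v := by
    rw [hudef, mul_smul_comm, ← mul_assoc, hn, neg_mul, Quaternion.coe_mul_eq_smul, smul_neg,
      smul_smul, neg_smul]
    congr 2
    field_simp
  have e1 := (h u hu).conj a b hn
  rw [conj_C_eq a b hn hnu] at e1
  have e2 := lift (quadratic a b) (h (-u) (by rw [star_neg, hu]))
  have e3 := quadratic_mul_const hA a hb h (u := (2 * b ^ 2 : ℝ) • u)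
    (by rw [Quaternion.star_smul, hu, smul_neg])
  convert ((e1.add (mul_ne_zero hM hA) e2).add (mul_ne_zero hM hA) e3) using 1
  clear_value u
  rw [hnu2, C_neg, mul_neg, ← smul_C, ← smul_C, mul_smul_comm]
  module

end TranslationFactors

/-! ### Partial fractions -/

/-- All translations with denominator `A` along a fixed direction factor. -/
def AllTranslationsFactor (A : ℝ[X]) : Prop :=
  ∀ f : ℝ[X], f.natDegree ≤ A.natDegree → ∀ e : ℍ[ℝ], star e = -e →
    TranslationFactors A (realQuat f * C e)

theorem realQuat_C_mul_C (c : ℝ) (e : ℍ[ℝ]) : realQuat (C c) * C e = C (c • e) := by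
  rw [coe_mapRingHom, map_C, ← C_mul]
  congr 1
  exact Quaternion.coe_mul_eq_smul c e

theorem AllTranslationsFactor.C_mul {A : ℝ[X]} (h : AllTranslationsFactor A) {c : ℝ}
    (hc : c ≠ 0) : AllTranslationsFactor (C c * A) := by
  intro f hf e he
  rw [natDegree_C_mul hc] at hf
  have h1 := TranslationFactors.lift (TranslationFactors.unit hc)
    (h (C c⁻¹ * f) ((natDegree_C_mul_le _ _).trans hf) e he)
  rwa [← mul_assoc, ← map_mul, ← mul_assoc, ← Polynomial.C_mul, mul_inv_cancel₀ hc, C_1,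
    one_mul] at h1

theorem allTranslationsFactor_one : AllTranslationsFactor 1 := by
  intro f hf e he
  rw [natDegree_one, Nat.le_zero] at hf
  rw [eq_C_of_natDegree_eq_zero hf, realQuat_C_mul_C]
  exact TranslationFactors.const (by rw [Quaternion.star_smul, he, smul_neg])

theorem AllTranslationsFactor.mul {A B : ℝ[X]} (hA0 : A ≠ 0) (hB0 : B ≠ 0)
    (hAB : IsCoprime A B) (hA : AllTranslationsFactor A) (hB : AllTranslationsFactor B) :
    AllTranslationsFactor (A * B) := by
  intro f hf e he
  obtain ⟨x, y, hxy⟩ := hAB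
  -- Bézout gives `f = A(fx) + B(fy)`. Reducing `fx` modulo `B` and moving the quotient into `U`
  -- bounds `W`; the degree of `U` is then read off from `B U = f - A W`.
  set W := f * x % B with hW
  set U := A * (f * x / B) + f * y with hU
  have hfUW : f = A * W + B * U := by
    have h1 : f * x = B * (f * x / B) + W := (EuclideanDomain.div_add_mod _ _).symm
    calc f = A * (f * x) + B * (f * y) := by linear_combination -f * hxy
      _ = _ := by rw [h1]; ring
  have hWd : W.natDegree ≤ B.natDegree :=
    natDegree_le_natDegree (EuclideanDomain.mod_lt (f * x) hB0).le
  have hUd : U.natDegree ≤ A.natDegree := by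
    by_cases hU0 : U = 0
    · rw [hU0, natDegree_zero]; exact Nat.zero_le _
    have h1 : (B * U).natDegree ≤ (A * B).natDegree := by
      rw [show B * U = f - A * W by rw [hfUW]; ring]
      refine (natDegree_sub_le _ _).trans (max_le hf (natDegree_mul_le.trans ?_))
      rw [natDegree_mul hA0 hB0]
      omega
    rw [natDegree_mul hB0 hU0, natDegree_mul hA0 hB0] at h1
    omega
  have h1 := (hA U hUd e he).mul (hB W hWd e he)
  rwa [← mul_assoc, ← mul_assoc, ← map_mul, ← map_mul, ← add_mul, ← map_add, ← hfUW] at h1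

/-- This is `f/(t - a) = c + d/(t - a)`: a constant translation composed with one linear factor. -/
theorem allTranslationsFactor_X_sub_C (a : ℝ) : AllTranslationsFactor (X - C a) := by
  intro f hf e he
  rw [natDegree_X_sub_C] at hf
  obtain ⟨c, d, rfl⟩ : ∃ c d : ℝ, f = (X - C a) * C c + C d := by
    obtain ⟨c, d, rfl⟩ := exists_eq_X_add_C_of_natDegree_le_one hf
    exact ⟨c, d + a * c, by rw [C_add, C_mul]; ring⟩
  have h1 := (TranslationFactors.linear a (u := d • e)
    (by rw [Quaternion.star_smul, he, smul_neg])).mul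
    (TranslationFactors.const (u := c • e) (by rw [Quaternion.star_smul, he, smul_neg]))
  rwa [mul_one, map_one, one_mul, ← realQuat_C_mul_C, ← realQuat_C_mul_C, ← mul_assoc,
    ← map_mul, ← add_mul, ← map_add] at h1

theorem allTranslationsFactor_quadratic_pow (a : ℝ) {b : ℝ} (hb : b ≠ 0) (k : ℕ) :
    AllTranslationsFactor (((X - C a) ^ 2 + C (b ^ 2)) ^ k) := by
  induction k with
  | zero => rw [pow_zero]; exact allTranslationsFactor_one
  | succ k ih =>
    obtain ⟨hMm, hMd⟩ := quadratic_monic_and_natDegree a b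
    have hconst : ∀ u : ℍ[ℝ], star u = -u →
        TranslationFactors (((X - C a) ^ 2 + C (b ^ 2)) ^ k) (C u) := by
      intro u hu
      simpa using ih 1 (by simp) u hu
    intro f hf e he
    have hMk : (((X - C a) ^ 2 + C (b ^ 2)) ^ k : ℝ[X]) ≠ 0 := pow_ne_zero _ hMm.ne_zero
    have hf0 : (f %ₘ ((X - C a) ^ 2 + C (b ^ 2))).natDegree ≤ 1 := by
      have := natDegree_modByMonic_lt f hMm (fun h => by rw [h] at hMd; simp at hMd)
      omega
    have hf1 : (f /ₘ ((X - C a) ^ 2 + C (b ^ 2))).natDegree ≤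
        (((X - C a) ^ 2 + C (b ^ 2)) ^ k : ℝ[X]).natDegree := by
      rw [natDegree_divByMonic _ hMm, hMm.natDegree_pow]
      rw [hMm.natDegree_pow] at hf
      rw [hMd] at hf ⊢
      omega
    obtain ⟨c, d, hcd⟩ : ∃ c d : ℝ,
        f %ₘ ((X - C a) ^ 2 + C (b ^ 2)) = (X - C a) * C c + C d := by
      obtain ⟨c, d, h⟩ := exists_eq_X_add_C_of_natDegree_le_one hf0
      exact ⟨c, d + a * c, by rw [h, C_add, C_mul]; ring⟩
    -- Dividing `f` by the quadratic: the quotient is handled by the induction hypothesis at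
    -- exponent `k`, the two parts of the remainder by conjugating constants over that denominator.
    have e1 := TranslationFactors.lift (TranslationFactors.quadratic a b) (ih _ hf1 e he)
    have e2 := TranslationFactors.quadratic_mul_const hMk a hb hconst (u := d • e)
      (by rw [Quaternion.star_smul, he, smul_neg])
    have e3 := TranslationFactors.quadratic_mul_linear hMk a hb hconst (v := c • e)
      (by rw [Quaternion.star_smul, he, smul_neg])
    have hne := mul_ne_zero hMm.ne_zero hMk
    have e4 := (e1.add hne e3).add hne e2
    rw [← realQuat_C_mul_C, ← realQuat_C_mul_C, ← mul_assoc, ← mul_assoc, ← map_mul, ← map_mul,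
      ← add_mul, ← add_mul, ← map_add, ← map_add, add_assoc, ← hcd, add_comm (_ * _),
      modByMonic_add_div, ← pow_succ'] at e4
    exact e4

theorem allTranslationsFactor_of_not_sq_dvd {A : ℝ[X]} (hA : ∀ a : ℝ, ¬ (X - C a) ^ 2 ∣ A) :
    AllTranslationsFactor A := by
  induction A using UniqueFactorizationMonoid.induction_on_coprime with
  | h0 => exact absurd (dvd_zero _) (hA 0)
  | @h1 x hx =>
    obtain ⟨c, hc, rfl⟩ := Polynomial.isUnit_iff.mp hx
    simpa using allTranslationsFactor_one.C_mul hc.ne_zero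
  | @hpr p i hp =>
    by_cases hr : ∃ a : ℝ, p.eval a = 0
    · obtain ⟨a, ha⟩ := hr
      rcases Nat.lt_or_ge i 2 with hi | hi
      · interval_cases i
        · rw [pow_zero]; exact allTranslationsFactor_one
        · obtain ⟨q, hq⟩ := dvd_iff_isRoot.mpr ha
          have hqu : IsUnit q := (hp.irreducible.isUnit_or_isUnit hq).resolve_left
            (not_isUnit_X_sub_C a)
          obtain ⟨c, hc, rfl⟩ := Polynomial.isUnit_iff.mp hqu
          rw [pow_one, hq, mul_comm]
          exact (allTranslationsFactor_X_sub_C a).C_mul hc.ne_zero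
      · exact absurd ((pow_dvd_pow_of_dvd (dvd_iff_isRoot.mpr ha) 2).trans (pow_dvd_pow p hi))
          (hA a)
    · push Not at hr
      obtain ⟨c, a, b, hc, hb, rfl⟩ := exists_eq_of_irreducible_of_eval_ne_zero hp.irreducible hr
      rw [mul_pow, ← C_pow]
      exact (allTranslationsFactor_quadratic_pow a hb i).C_mul (pow_ne_zero _ hc)
  | @hcp x y hxy ihx ihy =>
    refine AllTranslationsFactor.mul ?_ ?_ hxy.isCoprime
      (ihx fun a h => hA a (h.mul_right _)) (ihy fun a h => hA a (h.mul_left _))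
    · rintro rfl; exact hA 0 (by simp)
    · rintro rfl; exact hA 0 (by simp)

/-- The coefficients of `V` are purely imaginary, so `V` is a sum of its three coordinate
translations. -/
theorem translationFactors_of_not_sq_dvd {A : ℝ[X]} (hA : ∀ a : ℝ, ¬ (X - C a) ^ 2 ∣ A)
    {V : ℍ[ℝ][X]} (hV : quatConj V = -V) (hd : V.natDegree ≤ A.natDegree) :
    TranslationFactors A V := by
  have hA0 : A ≠ 0 := by rintro rfl; exact hA 0 (by simp)
  let L1 : ℍ[ℝ] →+ ℝ := ⟨⟨fun q => q.imI, by simp⟩, by simp⟩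
  let L2 : ℍ[ℝ] →+ ℝ := ⟨⟨fun q => q.imJ, by simp⟩, by simp⟩
  let L3 : ℍ[ℝ] →+ ℝ := ⟨⟨fun q => q.imK, by simp⟩, by simp⟩
  obtain ⟨i, i0, i1, i2, i3⟩ : ∃ q : ℍ[ℝ], q.re = 0 ∧ q.imI = 1 ∧ q.imJ = 0 ∧ q.imK = 0 :=
    ⟨⟨0, 1, 0, 0⟩, rfl, rfl, rfl, rfl⟩
  have hi : star i = -i := by ext <;> simp [*]
  obtain ⟨j, j0, j1, j2, j3⟩ : ∃ q : ℍ[ℝ], q.re = 0 ∧ q.imI = 0 ∧ q.imJ = 1 ∧ q.imK = 0 :=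
    ⟨⟨0, 0, 1, 0⟩, rfl, rfl, rfl, rfl⟩
  have hj : star j = -j := by ext <;> simp [*]
  obtain ⟨k, k0, k1, k2, k3⟩ : ∃ q : ℍ[ℝ], q.re = 0 ∧ q.imI = 0 ∧ q.imJ = 0 ∧ q.imK = 1 :=
    ⟨⟨0, 0, 0, 1⟩, rfl, rfl, rfl, rfl⟩
  have hk : star k = -k := by ext <;> simp [*]
  have e : V = realQuat (mapCoeff L1 V) * C i + realQuat (mapCoeff L2 V) * C j +
      realQuat (mapCoeff L3 V) * C k := by
    ext1 n
    have h1 : star (V.coeff n) = -V.coeff n := by rw [← coeff_quatConj, hV, coeff_neg]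
    have h2 : (V.coeff n).re = 0 := by
      have := congrArg (fun q : ℍ[ℝ] => q.re) h1
      simp only [Quaternion.re_star, Quaternion.re_neg] at this
      linarith
    simp only [coe_mapRingHom, coeff_add, coeff_mul_C, coeff_map, coeff_mapCoeff]
    change _ = ((V.coeff n).imI : ℍ[ℝ]) * i + ((V.coeff n).imJ : ℍ[ℝ]) * j +
      ((V.coeff n).imK : ℍ[ℝ]) * k
    ext <;> simp [*]
  have hall := allTranslationsFactor_of_not_sq_dvd hA
  rw [e]
  exact ((hall _ ((natDegree_mapCoeff_le _ _).trans hd) i hi).add hA0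
    (hall _ ((natDegree_mapCoeff_le _ _).trans hd) j hj)).add hA0
    (hall _ ((natDegree_mapCoeff_le _ _).trans hd) k hk)

/-! ### Reduction of motion polynomials to translations -/

/-- This is the dual part of the equation `F F̄ = N` with `N` real. -/
theorem primalPart_mul_quatConj {F : DualQuat[X]} (hF : IsMotionPolynomial F) {Q : ℍ[ℝ][X]}
    (hQ : F = quatDual (primalPart F) + dualUnit * quatDual Q) :
    primalPart F * quatConj Q + Q * quatConj (primalPart F) = 0 := by
  obtain ⟨⟨N, hN, -⟩, -⟩ := hF
  have h0 : ofReal N = quatDual (realQuat N) + dualUnit * quatDual 0 := by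
    rw [quatDual_realQuat]; simp
  generalize primalPart F = P at hQ
  subst hQ
  rw [normPoly, polyConj_quatDual_add, quatDual_add_mul, h0] at hN
  exact (quatDual_add_inj hN).2

theorem monic_list_prod_X_sub_C {R : Type*} [Ring R] [Nontrivial R] (l : List R) :
    (l.map fun x => X - C x).prod.Monic ∧
      (l.map fun x => X - C x).prod.natDegree = l.length := by
  induction l with
  | nil => simp
  | cons a l ih =>
    rw [List.map_cons, List.prod_cons]
    refine ⟨(monic_X_sub_C a).mul ih.1, ?_⟩
    rw [(monic_X_sub_C a).natDegree_mul ih.1, natDegree_X_sub_C, ih.2, List.length_cons, add_comm]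

theorem admitsMotionFactorization_of_mem {F : DualQuat[X]} (hF : F ∈ factorizable)
    (hd : 1 ≤ F.natDegree) : AdmitsMotionFactorization F := by
  obtain ⟨c, h, ⟨r, hr, hc, -⟩, hh, rfl⟩ := hF
  refine ⟨hd, c, h, ?_, fun x hx => (hh x hx).isMotionPolynomial, rfl⟩
  obtain ⟨hm, hl⟩ := monic_list_prod_X_sub_C h
  have hc0 : c ≠ 0 := by
    rintro rfl
    rw [zero_mul] at hc
    have := congrArg TrivSqZeroExt.fst hc
    rw [algebraMap_dualQuat, TrivSqZeroExt.fst_inl, TrivSqZeroExt.fst_zero,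
      ← Quaternion.coe_zero] at this
    exact hr (Quaternion.coe_injective this).symm
  rw [natDegree_mul' (by rwa [hm.leadingCoeff, mul_one, leadingCoeff_C]), natDegree_C, hl,
    zero_add]

theorem coeff_primalPart (F : DualQuat[X]) (n : ℕ) :
    (primalPart F).coeff n = (F.coeff n).fst := by
  simp [primalPart]

theorem natDegree_primalPart {F : DualQuat[X]} (hF : IsUnit F.leadingCoeff) :
    primalPart F ≠ 0 ∧ (primalPart F).natDegree = F.natDegree := by
  have h1 : (primalPart F).coeff F.natDegree ≠ 0 := by
    rw [coeff_primalPart]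
    exact (TrivSqZeroExt.isUnit_iff_isUnit_fst.mp hF).ne_zero
  exact ⟨fun h => h1 (by rw [h, coeff_zero]),
    le_antisymm natDegree_map_le (le_natDegree_of_ne_zero h1)⟩

/-- A real zero `a` of the cofactor would split off the central factor `t - a`, against maximality
of `p`. -/
theorem eval_ne_zero_of_isMaxRealFactor {P G : ℍ[ℝ][X]} {p : ℝ[X]} (hp : IsMaxRealFactor p P)
    (hG : P = realQuat p * G) (a : ℝ) : G.eval (a : ℍ[ℝ]) ≠ 0 := by
  intro h0
  obtain ⟨G', rfl⟩ := exists_realQuat_X_sub_C_mul h0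
  have := hp.2.2 (p * (X - C a)) ⟨G', by
    rw [hG, ← mul_assoc, ← map_mul]; rfl⟩
  rw [natDegree_mul hp.1.ne_zero (X_sub_C_ne_zero a), natDegree_X_sub_C] at this
  omega

theorem eval_realQuat_ne_zero {p : ℝ[X]} {a : ℝ} (h : p.eval a ≠ 0) :
    (realQuat p).eval (a : ℍ[ℝ]) ≠ 0 := by
  rw [eval_realQuat, ← Quaternion.coe_zero]
  exact fun e => h (Quaternion.coe_injective e)

theorem exists_mul_ofReal_mem_factorizable {F : DualQuat[X]} (hlead : IsUnit F.leadingCoeff)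
    (hmotion : IsMotionPolynomial F)
    (hmult : ∀ a : ℝ, (mrpf (primalPart F)).IsRoot a →
      (mrpf (primalPart F)).rootMultiplicity a = 1) :
    ∃ D : ℝ[X], D ≠ 0 ∧ F * ofReal D ∈ factorizable := by
  obtain ⟨Q, hQd, hQ⟩ := exists_quatDual_add F
  obtain ⟨hP0, hPd⟩ := natDegree_primalPart hlead
  have hPQ := primalPart_mul_quatConj hmotion hQ
  have hp := (mrpf_eq_iff hP0).mp rfl
  rw [← hPd] at hQd
  generalize primalPart F = P at *
  generalize mrpf P = p at *
  obtain ⟨G, hG⟩ : ∃ G, P = realQuat p * G := hp.2.1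
  have hGa := eval_ne_zero_of_isMaxRealFactor hp hG
  obtain ⟨p₂, hp₂, -, hroots⟩ := exists_prod_multiset_X_sub_C_mul p
  set R : ℝ[X] := (p.roots.map fun a => X - C a).prod with hR
  have hR0 : R ≠ 0 := by rintro h; rw [h, zero_mul] at hp₂; exact hp.1.ne_zero hp₂.symm
  have hp₂0 : p₂ ≠ 0 := by rintro rfl; rw [mul_zero] at hp₂; exact hp.1.ne_zero hp₂.symm
  have hp₂a : ∀ a : ℝ, p₂.eval a ≠ 0 := by
    intro a ha
    have := (mem_roots hp₂0).mpr ha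
    rw [hroots] at this
    simp at this
  set P' := realQuat p₂ * G with hP'
  have hPR : P = realQuat R * P' := by rw [hP', ← mul_assoc, ← map_mul, hp₂, hG]
  have hP'a : ∀ a : ℝ, P'.eval (a : ℍ[ℝ]) ≠ 0 := by
    intro a
    rw [hP', eval_coe_mul]
    exact mul_ne_zero (eval_realQuat_ne_zero (hp₂a a)) (hGa a)
  obtain ⟨N, hN⟩ := exists_realQuat_eq_mul_quatConj P'
  have hNa : ∀ a : ℝ, N.eval a ≠ 0 := by
    intro a ha
    have h2 := eval_realQuat N a
    rw [hN, eval_coe_mul, eval_quatConj, ha, Quaternion.coe_zero] at h2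
    exact mul_ne_zero (hP'a a) (star_ne_zero.mpr (hP'a a)) h2
  have hN0 : N ≠ 0 := by rintro rfl; exact hNa 0 (by simp)
  have hP'0 : P' ≠ 0 := fun h => hP'a 0 (by simp [h])
  have hP'c0 : quatConj P' ≠ 0 := by
    intro h
    rw [h, mul_zero, coe_mapRingHom, Polynomial.map_eq_zero_iff (algebraMap ℝ ℍ[ℝ]).injective] at hN
    exact hN0 hN
  have hRq0 : realQuat R ≠ 0 :=
    (Polynomial.map_ne_zero_iff (algebraMap ℝ ℍ[ℝ]).injective).mpr hR0
  -- `N` has no real zero, so such a square would divide `R`, hence `p`, whose real zeros are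
  -- simple.
  have hsq : ∀ a : ℝ, ¬ (X - C a) ^ 2 ∣ R * N := by
    intro a h
    have hcop : IsCoprime ((X - C a) ^ 2) N :=
      (((irreducible_X_sub_C a).coprime_iff_not_dvd).mpr
        fun h => hNa a (dvd_iff_isRoot.mp h)).pow_left
    have h2 : (X - C a) ^ 2 ∣ p := by
      rw [← hp₂]; exact (hcop.dvd_of_dvd_mul_right h).mul_right _
    have h3 := (le_rootMultiplicity_iff hp.1.ne_zero).mpr h2
    have h4 := hmult a (dvd_iff_isRoot.mp ((dvd_pow_self _ two_ne_zero).trans h2))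
    omega
  -- The norm condition is `R` times `P' Q̄ + Q P̄' = 0`, and `P' Q̄` is the conjugate of `Q P̄'`.
  have hV : quatConj (Q * quatConj P') = -(Q * quatConj P') := by
    rw [quatConj_mul, quatConj_quatConj]
    refine eq_neg_of_add_eq_zero_left (mul_left_cancel₀ hRq0 ?_)
    rw [mul_zero, ← hPQ, hPR, quatConj_mul (realQuat R), quatConj_realQuat, mul_add,
      ← mul_assoc (realQuat R), commute_realQuat R (Q * quatConj P'), mul_assoc Q]
  -- The invertible leading coefficient gives `deg Q ≤ deg P = deg R + deg P'`, while `deg N = 2 deg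
  -- P'`; thus the translation `V/(RN)` has no polynomial part of positive degree.
  have hVd : (Q * quatConj P').natDegree ≤ (R * N).natDegree := by
    have h1 : N.natDegree = P'.natDegree + P'.natDegree := by
      rw [← natDegree_map (algebraMap ℝ ℍ[ℝ]), ← coe_mapRingHom, hN, natDegree_mul hP'0 hP'c0,
        natDegree_quatConj]
    have h2 : P.natDegree = R.natDegree + P'.natDegree := by
      rw [hPR, natDegree_mul hRq0 hP'0, coe_mapRingHom, natDegree_map]
    have h3 : (Q * quatConj P').natDegree ≤ Q.natDegree + P'.natDegree := by
      rw [← natDegree_quatConj P']; exact natDegree_mul_le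
    rw [natDegree_mul hR0 hN0]
    omega
  obtain ⟨D, hD, hmem⟩ := translationFactors_of_not_sq_dvd hsq hV hVd
  refine ⟨N * D, mul_ne_zero hN0 hD, ?_⟩
  have hFN : F * ofReal N = translation (R * N) (Q * quatConj P') * quatDual P' := by
    have h0 : ∀ P : ℍ[ℝ][X], quatDual P = quatDual P + dualUnit * quatDual 0 := by simp
    rw [hQ, ← quatDual_realQuat, h0 (realQuat N), quatDual_add_mul, translation, h0 P',
      quatDual_add_mul, hPR, map_mul realQuat, mul_assoc (realQuat R) P',
      ← commute_realQuat N P', ← mul_assoc (realQuat R) (realQuat N), mul_assoc Q, quatConj_mul_self,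
      ← hN]
    simp only [mul_zero]
  have : F * ofReal (N * D) =
      translation (R * N) (Q * quatConj P') * ofReal D * quatDual P' := by
    rw [ofReal_mul, ← mul_assoc, hFN, mul_assoc, ← commute_ofReal, ← mul_assoc]
  rw [this]
  exact mul_mem hmem (quatDual_mem_factorizable hP'a)

theorem natDegree_le_natDegree_mul_ofReal {F : DualQuat[X]} (hlead : IsUnit F.leadingCoeff)
    {D : ℝ[X]} (hD : D ≠ 0) : F.natDegree ≤ (F * ofReal D).natDegree := by
  have h1 : (ofReal D).leadingCoeff = algebraMap ℝ DualQuat D.leadingCoeff :=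
    leadingCoeff_map _
  have h2 : ofReal D ≠ 0 := (Polynomial.map_ne_zero_iff (algebraMap ℝ DualQuat).injective).mpr hD
  rw [natDegree_mul' (by
    rw [Ne, hlead.mul_right_eq_zero]; exact leadingCoeff_ne_zero.mpr h2)]
  exact Nat.le_add_right _ _

/-- A real zero makes `mrpf` nonconstant. Unboundedness serves only to exclude degree zero. -/
theorem one_le_natDegree_of_not_isBounded {F : DualQuat[X]} (hlead : IsUnit F.leadingCoeff)
    (hF : ¬ IsBounded F) : 1 ≤ F.natDegree := by
  obtain ⟨hP0, hPd⟩ := natDegree_primalPart hlead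
  have hp := (mrpf_eq_iff hP0).mp rfl
  simp only [IsBounded, not_forall, not_not] at hF
  obtain ⟨a, ha⟩ := hF
  obtain ⟨G, hG⟩ := hp.2.1
  have hG0 : G ≠ 0 := by rintro rfl; rw [mul_zero] at hG; exact hP0 hG
  have h1 : 0 < (mrpf (primalPart F)).natDegree :=
    natDegree_pos_iff_degree_pos.mpr (degree_pos_of_root hp.1.ne_zero ha)
  have h2 := congrArg natDegree hG
  rw [natDegree_mul ((Polynomial.map_ne_zero_iff (algebraMap ℝ ℍ[ℝ]).injective).mpr hp.1.ne_zero)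
    hG0, natDegree_map, hPd] at h2
  omega

end MotionPoly

theorem mainTheorem2 (F : Polynomial MotionPoly.DualQuat)
    (hlead : IsUnit F.leadingCoeff)
    (hmotion : MotionPoly.IsMotionPolynomial F)
    (hunbounded : ¬ MotionPoly.IsBounded F)
    (hmult : ∀ a : ℝ, (MotionPoly.mrpf (MotionPoly.primalPart F)).IsRoot a →
      (MotionPoly.mrpf (MotionPoly.primalPart F)).rootMultiplicity a = 1) :
    ∃ D : Polynomial ℝ, D ≠ 0 ∧
      MotionPoly.AdmitsMotionFactorization (F * MotionPoly.ofReal D) := by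
  obtain ⟨D, hD, hmem⟩ := MotionPoly.exists_mul_ofReal_mem_factorizable hlead hmotion hmult
  exact ⟨D, hD, MotionPoly.admitsMotionFactorization_of_mem hmem
    ((MotionPoly.one_le_natDegree_of_not_isBounded hlead hunbounded).trans
      (MotionPoly.natDegree_le_natDegree_mul_ofReal hlead hD))⟩
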